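/- Let $P(\lambda)=A_m\lambda^m+\cdots+A_1\lambda+A_0$ with $A_0,\dots,A_m\in\mathbb C^{n\times n}$ and $\det A_m\neq 0$, and let $w_0>0$, $w_1,\dots,w_m\ge 0$ be weights, $w(t)=w_mt^m+\cdots+w_1t+w_0$. An eigenvalue of $P$ is a zero of $\det P$, its algebraic multiplicity is its order as a zero, and it is multiple if this is at least $2$. Write $\|\cdot\|$ for the spectral norm. For $\varepsilon>0$ the weighted $\varepsilon$-pseudospectrum of $P$ is $$\sigma_\varepsilon(P)=\Big\{\mu\in\mathbb C:\ \det\Big(\sum_{j=0}^m(A_j+\Delta_j)\mu^j\Big)=0\ \text{ for some }\Delta_j\in\mathbb C^{n\times n}\text{ with }\|\Delta_j\|\le\varepsilon w_j,\ 0\le j\le m\Big\}.$$ A Jordan chain of $P$ of length $s\ge 1$ at $\lambda_i$ is a sequence $x_{i,1}\ne 0,x_{i,2},\dots,x_{i,s}$ in $\mathbb C^n$ with $\sum_{j=1}^{\xi}\frac1{(j-1)!}P^{(j-1)}(\lambda_i)x_{i,\xi-j+1}=0$ for $\xi=1,\dots,s$. Take a complete system of Jordan chains of $P$, that is, finitely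 many chains of lengths $s_1,\dots,s_r$ at eigenvalues $\lambda_1,\dots,\lambda_r$ (repetitions allowed) such that $s_1+\cdots+s_r=nm$ and, for each eigenvalue, the first vectors of its chains are linearly independent. Let $X\in\mathbb C^{n\times nm}$ be the matrix whose columns are the vectors of these chains in order, $J=J_1\oplus\cdots\oplus J_r$ with $J_i$ the $s_i\times s_i$ upper Jordan block with eigenvalue $\lambda_i$, and $$Y=\begin{bmatrix}X\\XJ\\\vdots\\XJ^{m-1}\end{bmatrix}^{-1}\begin{bmatrix}0\\\vdots\\0\\A_m^{-1}\end{bmatrix}\in\mathbb C^{nm\times n}.$$ Let $\lambda_0$ be a multiple eigenvalue of $P$, let $p_0$ be the size of the largest Jordan blocks of $J$ with eigenvalue $\lambda_0$, and let $\kappa_0$ be the number of such blocks of size $p_0$. Let $\hat X\in\mathbb C^{n\times\kappa_0}$ have as columns the first columns of $X$, and let $\hat Y\in\mathbb C^{\kappa_0\times n}$ have as rows the last rows of $Y$, in the positions of these $\kappa_0$ blocks (taken in the same order). Put $\hat k(P,\lambda_0)=w(|\lambda_0|)\,\|\hat X\hat Y\|$. Then, as $\varepsilon\to 0^+$, the Hausdorff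 distance between the connected component of $\sigma_\varepsilon(P)$ that contains $\lambda_0$ and the disc $\{\mu\in\mathbb C:|\mu-\lambda_0|\le(\hat k(P,\lambda_0)\,\varepsilon)^{1/p_0}\}$ is finite for all sufficiently small $\varepsilon$ and is $o(\varepsilon^{1/p_0})$. -/

import Mathlib

open scoped Matrix.Norms.L2Operator Topology

noncomputable section

/-- The coefficients `A_0, …, A_m` of an `n × n` complex matrix polynomial
`P(z) = A_m z^m + ⋯ + A_1 z + A_0`. -/
abbrev MatPoly (n m : ℕ) : Type := Fin (m + 1) → Matrix (Fin n) (Fin n) ℂ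

namespace MatPoly

variable {n m : ℕ}

/-- The matrix polynomial as a matrix with entries in `ℂ[X]`. -/
def toMatrix (A : MatPoly n m) : Matrix (Fin n) (Fin n) (Polynomial ℂ) :=
  ∑ j : Fin (m + 1), (Polynomial.X ^ (j : ℕ) : Polynomial ℂ) • (A j).map Polynomial.C

/-- The value `P(z)`. -/
def eval (A : MatPoly n m) (z : ℂ) : Matrix (Fin n) (Fin n) ℂ :=
  ∑ j : Fin (m + 1), z ^ (j : ℕ) • A j

/-- The value `P^{(k)}(z)` of the `k`-th derivative of `P`. -/
def derivAt (A : MatPoly n m) (k : ℕ) (z : ℂ) : Matrix (Fin n) (Fin n) ℂ :=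
  A.toMatrix.map fun p => (Polynomial.derivative^[k] p).eval z

/-- The spectrum `σ(P)`: the zeros of `det P(z)`. -/
def spec (A : MatPoly n m) : Set ℂ := {z | (A.eval z).det = 0}

/-- The algebraic multiplicity of `z`: its multiplicity as a zero of the polynomial `det P`. -/
def algMult (A : MatPoly n m) (z : ℂ) : ℕ := A.toMatrix.det.rootMultiplicity z

/-- The scalar polynomial `w(t) = w_m t^m + ⋯ + w_1 t + w_0` attached to the weights. -/
def weight (w : Fin (m + 1) → ℝ) (t : ℝ) : ℝ := ∑ j : Fin (m + 1), w j * t ^ (j : ℕ)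

/-- The weighted `ε`-pseudospectrum: all eigenvalues of the perturbed polynomials
`∑ (A_j + Δ_j) z^j` with `‖Δ_j‖ ≤ ε w_j` in the spectral norm. -/
def pseudospectrum (A : MatPoly n m) (w : Fin (m + 1) → ℝ) (ε : ℝ) : Set ℂ :=
  {z | ∃ Δ : MatPoly n m, (∀ j, ‖Δ j‖ ≤ ε * w j) ∧ z ∈ spec (A + Δ)}

/-- `x 0, …, x (s - 1)` is a Jordan chain of length `s` of `P` at `z` (the first vector, with
index `0`, is the eigenvector; the values `x k` with `k ≥ s` are irrelevant). -/
structure IsJordanChain (A : MatPoly n m) (z : ℂ) (s : ℕ) (x : ℕ → Fin n → ℂ) : Prop where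
  pos : 0 < s
  ne_zero : x 0 ≠ 0
  eq_zero : ∀ ξ < s, ∑ j ∈ Finset.range (ξ + 1),
    ((j.factorial : ℂ)⁻¹ • A.derivAt j z).mulVec (x (ξ - j)) = 0

/-- A complete system of Jordan chains of `P`, i.e. the data that define a Jordan triple
`(X, J, Y)`: Jordan chains whose eigenvectors are linearly independent for each eigenvalue and
whose lengths add up to `n m`. (No chain of such a system can be prolonged.) -/
structure JordanSystem (A : MatPoly n m) where
  /-- number of chains -/
  r : ℕ
  /-- eigenvalue of each chain -/
  eig : Fin r → ℂ
  /-- length of each chain -/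
  len : Fin r → ℕ
  /-- vectors of each chain -/
  vec : Fin r → ℕ → Fin n → ℂ
  isChain : ∀ i, A.IsJordanChain (eig i) (len i) (vec i)
  indep : ∀ z : ℂ, LinearIndependent ℂ fun i : {i : Fin r // eig i = z} => vec i 0
  sum_len : ∑ i, len i = n * m

/-- The `s × s` Jordan block with eigenvalue `z` and ones on the superdiagonal. -/
def jordanBlock (z : ℂ) (s : ℕ) : Matrix (Fin s) (Fin s) ℂ :=
  Matrix.of fun a b => if a = b then z else if (a : ℕ) + 1 = b then 1 else 0

namespace JordanSystem

variable {A : MatPoly n m} (T : JordanSystem A)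

/-- Index set of the columns of `X`: pairs (chain, position in the chain). -/
abbrev Idx : Type := Σ i : Fin T.r, Fin (T.len i)

/-- The `n × nm` matrix `X` whose columns are the vectors of the chains. -/
def X : Matrix (Fin n) T.Idx ℂ := Matrix.of fun a c => T.vec c.1 c.2 a

/-- The `nm × nm` Jordan matrix `J`, the direct sum of the Jordan blocks of the chains. -/
def J : Matrix T.Idx T.Idx ℂ :=
  Matrix.blockDiagonal' fun i => jordanBlock (T.eig i) (T.len i)

/-- The `nm × nm` matrix `Q` with block rows `X, X J, …, X J^{m-1}`. -/
def Q : Matrix (Fin m × Fin n) T.Idx ℂ := Matrix.of fun p c => (T.X * T.J ^ (p.1 : ℕ)) p.2 c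

/-- The `nm × n` matrix with block rows `0, …, 0, A_m⁻¹`. -/
def lastBlock (A : MatPoly n m) : Matrix (Fin m × Fin n) (Fin n) ℂ :=
  Matrix.of fun p b => if (p.1 : ℕ) + 1 = m then (A (Fin.last m))⁻¹ p.2 b else 0

theorem card_idx : Fintype.card T.Idx = Fintype.card (Fin m × Fin n) := by
  simp [T.sum_len, mul_comm]

/-- A numbering of the columns of `X` by the row indices of `Q`, used only to form the inverse
of `Q` as that of a square matrix. -/
def numbering : T.Idx ≃ Fin m × Fin n := Fintype.equivOfCardEq T.card_idx

/-- The `nm × n` matrix `Y = Q⁻¹ [0; …; 0; A_m⁻¹]`. -/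
def Y : Matrix T.Idx (Fin n) ℂ :=
  ((T.Q.submatrix id T.numbering.symm)⁻¹ * lastBlock A).submatrix T.numbering id

/-- The size `p₀` of the largest Jordan blocks with eigenvalue `z`. -/
def maxBlockSize (z : ℂ) : ℕ := (Finset.univ.filter fun i => T.eig i = z).sup T.len

/-- The Jordan blocks with eigenvalue `z` of maximal size `p₀`. -/
abbrev MaxBlock (z : ℂ) : Type := {i : Fin T.r // T.eig i = z ∧ T.len i = T.maxBlockSize z}

/-- The position of the last vector of the chain `i`. -/
def lastIdx (i : Fin T.r) : T.Idx :=
  ⟨i, ⟨T.len i - 1, Nat.sub_lt (T.isChain i).pos Nat.one_pos⟩⟩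

/-- The matrix `X̂`: its columns are the right eigenvectors that head the largest chains at `z`. -/
def hatX (z : ℂ) : Matrix (Fin n) (T.MaxBlock z) ℂ := Matrix.of fun a i => T.vec i.1 0 a

/-- The matrix `Ŷ`: its rows are the associated left eigenvectors (conjugate transposed), that
is, the last of the rows of `Y` in each of the largest blocks at `z`. -/
def hatY (z : ℂ) : Matrix (T.MaxBlock z) (Fin n) ℂ := Matrix.of fun i b => T.Y (T.lastIdx i.1) b

/-- The condition number `k̂(P, z) = w(|z|) ‖X̂ Ŷ‖` (spectral norm). -/
def condNumber (w : Fin (m + 1) → ℝ) (z : ℂ) : ℝ := weight w ‖z‖ * ‖T.hatX z * T.hatY z‖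

end JordanSystem

end MatPoly

end

/-!
The proof rests on two descriptions of the situation near the eigenvalue `l0`.

The first is that of the pseudospectrum by the resolvent norm. If `P(z)` is invertible, the smallest
perturbation of it that is singular has norm `‖P(z)⁻¹‖⁻¹`
(`Matrix.exists_norm_le_det_add_eq_zero_iff`), and the admissible perturbations of the
coefficients produce at `z` exactly the matrices of norm at most `ε w(|z|)`
(`MatPoly.exists_eval_eq`). Hence `z ∈ σ_ε(P)` if and only if `1 ≤ ε w(|z|) ‖P(z)⁻¹‖`.

The second is the formula `P(z)⁻¹ = X (z I - J)⁻¹ Y`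
(`MatPoly.JordanSystem.eval_mul_X_mul_resolvent_mul_Y`). The chain conditions say that
`∑ A_j X J^j = 0`, so that `P(z) X = ∑ A_j X (z^j I - J^j)`; dividing by `z I - J` and using
`X J^j Y = 0` for `j < m - 1` and `X J^(m-1) Y = A_m⁻¹` leaves the identity. That `Y` has these
properties depends on the invertibility of `Q`, which follows from the independence of
the eigenvectors. By the explicit form of the resolvent of a Jordan block,
`(z - l0)^p P(z)⁻¹` tends to `X̂ Ŷ` as `z → l0`, where `p` is the size of the largest blocks at `l0`.

Together they show that near `l0` the pseudospectrum is the set `|z - l0|^p ≤ ε g(z)`, where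
`g(z) = w(|z|) ‖(z - l0)^p P(z)⁻¹‖` tends to the condition number `K`. For each `δ > 0` and all
small `ε` the component of `l0` is then caught between the discs of radii `((K ± δ) ε)^(1/p)` (with
`0` for `K - δ` if that is negative), because a connected set cannot cross an annulus that misses the pseudospectrum
(`hausdorffDist_connectedComponentIn_closedBall`).
-/

/-! ### Distance to singularity and pseudospectra -/

/-- A linear map `R` attains its norm at some unit vector `x`, and the rank one matrix sending
`R x` to `-x` is a smallest perturbation making the inverse of `R` singular. -/
theorem Matrix.exists_norm_le_det_add_eq_zero_iff {ι : Type*} [Fintype ι] [DecidableEq ι]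
    [Nonempty ι] {M R : Matrix ι ι ℂ} (h : M * R = 1) (δ : ℝ) :
    (∃ E : Matrix ι ι ℂ, ‖E‖ ≤ δ ∧ (M + E).det = 0) ↔ 1 ≤ δ * ‖R‖ := by
  constructor
  · rintro ⟨E, hE, hdet⟩
    by_contra! hlt
    have hER : ‖-(E * R)‖ < 1 := by
      rw [norm_neg]
      calc ‖E * R‖ ≤ ‖E‖ * ‖R‖ := Matrix.l2_opNorm_mul E R
        _ ≤ δ * ‖R‖ := by gcongr
        _ < 1 := hlt
    have hunit : IsUnit ((M + E) * R) := by
      have := (Units.oneSub (-(E * R)) hER).isUnit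
      rwa [Units.val_oneSub, sub_neg_eq_add, ← h, ← add_mul] at this
    rw [Matrix.isUnit_iff_isUnit_det, Matrix.det_mul, hdet, zero_mul] at hunit
    exact not_isUnit_zero hunit
  · intro hδ
    set T := Matrix.toEuclideanCLM (n := ι) (𝕜 := ℂ) R with hT
    have hTn : ‖T‖ = ‖R‖ := rfl
    have hR : 0 < ‖R‖ := by
      rcases (norm_nonneg R).eq_or_lt with h0 | h0
      · rw [← h0] at hδ; norm_num at hδ
      · exact h0
    obtain ⟨x, hx, hmax⟩ := (isCompact_sphere (0 : EuclideanSpace ℂ ι) 1).exists_isMaxOn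
      (NormedSpace.sphere_nonempty.2 zero_le_one) (T.continuous.norm.continuousOn)
    have hx1 : ‖x‖ = 1 := by simpa using hx
    have hTx : ‖T‖ ≤ ‖T x‖ := by
      refine T.opNorm_le_of_unit_norm (norm_nonneg _) fun y hy => ?_
      exact hmax (by simpa using hy)
    have hTx0 : 0 < ‖T x‖ := by rw [← hTn] at hR; exact hR.trans_le hTx
    set E' := (-((‖T x‖ : ℂ) ^ 2)⁻¹) • InnerProductSpace.rankOne ℂ x (T x) with hE'
    set E := (Matrix.toEuclideanCLM (n := ι) (𝕜 := ℂ)).symm E' with hE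
    have hEE' : Matrix.toEuclideanCLM (n := ι) (𝕜 := ℂ) E = E' := by simp [hE]
    refine ⟨E, ?_, ?_⟩
    · have h1 : ‖E‖ = ‖T x‖⁻¹ := by
        rw [← Matrix.l2_opNorm_toEuclideanCLM, hEE', hE', norm_smul,
          InnerProductSpace.norm_rankOne, hx1]
        simp only [norm_neg, norm_inv, norm_pow, Complex.norm_real, norm_norm, one_mul]
        field_simp
      rw [h1]
      calc ‖T x‖⁻¹ ≤ ‖R‖⁻¹ := by rw [← hTn] at hR ⊢; gcongr
        _ ≤ δ := by rw [inv_le_iff_one_le_mul₀ hR]; exact hδ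
    · rw [← Matrix.exists_mulVec_eq_zero_iff]
      refine ⟨WithLp.ofLp (T x), ?_, ?_⟩
      · intro h0
        have : T x = 0 := by ext i; exact congrFun h0 i
        rw [this, norm_zero] at hTx0
        exact lt_irrefl _ hTx0
      · rw [Matrix.add_mulVec]
        have e1 : M.mulVec (WithLp.ofLp (T x)) = WithLp.ofLp x := by
          rw [hT, Matrix.ofLp_toEuclideanCLM, Matrix.mulVec_mulVec, h, Matrix.one_mulVec]
        have e2 : E.mulVec (WithLp.ofLp (T x)) = - WithLp.ofLp x := by
          rw [← Matrix.ofLp_toEuclideanCLM, hEE', hE', _root_.smul_apply,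
            InnerProductSpace.rankOne_apply, inner_self_eq_norm_sq_to_K, smul_smul, neg_mul]
          have : (‖T x‖ : ℂ) ≠ 0 := by exact_mod_cast hTx0.ne'
          rw [RCLike.ofReal_eq_complex_ofReal, inv_mul_cancel₀ (pow_ne_zero 2 this)]
          simp
        rw [e1, e2, add_neg_cancel]

namespace MatPoly

variable {n m : ℕ}

theorem eval_add (A B : MatPoly n m) (z : ℂ) : (A + B).eval z = A.eval z + B.eval z := by
  simp [eval, Finset.sum_add_distrib]

theorem det_toMatrix_eval (A : MatPoly n m) (z : ℂ) :
    A.toMatrix.det.eval z = (A.eval z).det := by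
  rw [← Polynomial.coe_evalRingHom, RingHom.map_det]
  congr 1
  ext a b
  simp [toMatrix, eval, Matrix.sum_apply]
  exact Finset.sum_congr rfl fun j _ => mul_comm _ _

theorem norm_eval_le {Δ : MatPoly n m} {w : Fin (m + 1) → ℝ} {ε : ℝ}
    (h : ∀ j, ‖Δ j‖ ≤ ε * w j) (z : ℂ) : ‖Δ.eval z‖ ≤ ε * weight w ‖z‖ := by
  rw [eval, weight, Finset.mul_sum]
  refine (norm_sum_le _ _).trans (Finset.sum_le_sum fun j _ => ?_)
  rw [norm_smul, norm_pow, ← mul_assoc, mul_comm]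
  gcongr
  exact h j

theorem weight_pos {w : Fin (m + 1) → ℝ} (hw : ∀ j, 0 ≤ w j) (hw0 : 0 < w 0) {t : ℝ}
    (ht : 0 ≤ t) : 0 < weight w t := by
  refine Finset.sum_pos' (fun j _ => mul_nonneg (hw j) (pow_nonneg ht _)) ⟨0, Finset.mem_univ _, ?_⟩
  simpa using hw0

theorem continuous_weight (w : Fin (m + 1) → ℝ) : Continuous (weight w) := by
  unfold weight
  fun_prop

/-- Every matrix of norm at most `ε w(|z|)` is the value at `z` of an admissible perturbation:
distribute it over the coefficients in proportion to `w j * ‖z‖ ^ j` and correct the phases. -/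
theorem exists_eval_eq {w : Fin (m + 1) → ℝ} (hw : ∀ j, 0 ≤ w j) (hw0 : 0 < w 0) {ε : ℝ}
    {z : ℂ} {E : Matrix (Fin n) (Fin n) ℂ} (hE : ‖E‖ ≤ ε * weight w ‖z‖) :
    ∃ Δ : MatPoly n m, (∀ j, ‖Δ j‖ ≤ ε * w j) ∧ Δ.eval z = E := by
  have hpos := weight_pos hw hw0 (norm_nonneg z)
  -- For `z = 0` this is `0`, which is harmless because then only the coefficient `j = 0` matters.
  set s : ℂ := starRingEnd ℂ z / ‖z‖ with hs
  have hsz : z * s = ‖z‖ := by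
    rcases eq_or_ne z 0 with rfl | hz
    · simp
    · have : (‖z‖ : ℂ) ≠ 0 := by simpa using hz
      rw [hs, ← mul_div_assoc, Complex.mul_conj', sq, mul_div_assoc, div_self this, mul_one]
  have hs1 : ‖s‖ ≤ 1 := by
    rw [hs, norm_div, RCLike.norm_conj, Complex.norm_real, norm_norm]
    exact div_self_le_one _
  refine ⟨fun j => ((w j / weight w ‖z‖ : ℝ) * s ^ (j : ℕ) : ℂ) • E, fun j => ?_, ?_⟩
  · have hwj : 0 ≤ w j / weight w ‖z‖ := div_nonneg (hw j) hpos.le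
    rw [norm_smul, norm_mul, Complex.norm_real, Real.norm_of_nonneg hwj, norm_pow]
    calc w j / weight w ‖z‖ * ‖s‖ ^ (j : ℕ) * ‖E‖
        ≤ w j / weight w ‖z‖ * 1 * (ε * weight w ‖z‖) := by
          gcongr
          exact pow_le_one₀ (norm_nonneg _) hs1
      _ = ε * w j := by field_simp
  · simp only [eval, smul_smul]
    rw [← Finset.sum_smul]
    have : ∑ j : Fin (m + 1), z ^ (j : ℕ) * (((w j / weight w ‖z‖ : ℝ) : ℂ) * s ^ (j : ℕ))
        = ((∑ j : Fin (m + 1), w j * ‖z‖ ^ (j : ℕ)) / weight w ‖z‖ : ℝ) := by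
      rw [Finset.sum_div, Complex.ofReal_sum]
      refine Finset.sum_congr rfl fun j _ => ?_
      rw [mul_left_comm, ← mul_pow, hsz]
      push_cast
      ring
    rw [this, show (∑ j : Fin (m + 1), w j * ‖z‖ ^ (j : ℕ)) = weight w ‖z‖ from rfl,
      div_self hpos.ne', Complex.ofReal_one, one_smul]

theorem mem_pseudospectrum_iff_exists {A : MatPoly n m} {w : Fin (m + 1) → ℝ} (hw : ∀ j, 0 ≤ w j)
    (hw0 : 0 < w 0) {ε : ℝ} {z : ℂ} : z ∈ A.pseudospectrum w ε ↔
      ∃ E : Matrix (Fin n) (Fin n) ℂ, ‖E‖ ≤ ε * weight w ‖z‖ ∧ (A.eval z + E).det = 0 := by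
  constructor
  · rintro ⟨Δ, hΔ, hz⟩
    exact ⟨Δ.eval z, norm_eval_le hΔ z, by rw [← eval_add]; exact hz⟩
  · rintro ⟨E, hE, hz⟩
    obtain ⟨Δ, hΔ, rfl⟩ := exists_eval_eq hw hw0 hE
    exact ⟨Δ, hΔ, by rw [spec, Set.mem_ofPred_eq, eval_add]; exact hz⟩

/-- At a point where `P` has inverse `R`, the pseudospectrum is the set where
`‖R‖⁻¹ ≤ ε w(|z|)`. -/
theorem mem_pseudospectrum_iff [NeZero n] {A : MatPoly n m} {w : Fin (m + 1) → ℝ}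
    (hw : ∀ j, 0 ≤ w j) (hw0 : 0 < w 0) {ε : ℝ} {z : ℂ} {R : Matrix (Fin n) (Fin n) ℂ}
    (hR : A.eval z * R = 1) :
    z ∈ A.pseudospectrum w ε ↔ 1 ≤ ε * weight w ‖z‖ * ‖R‖ := by
  rw [mem_pseudospectrum_iff_exists hw hw0, Matrix.exists_norm_le_det_add_eq_zero_iff hR]

theorem mem_pseudospectrum_of_mem_spec {A : MatPoly n m} {w : Fin (m + 1) → ℝ}
    (hw : ∀ j, 0 ≤ w j) {ε : ℝ} (hε : 0 ≤ ε) {z : ℂ} (hz : z ∈ A.spec) :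
    z ∈ A.pseudospectrum w ε :=
  ⟨0, fun j => by simpa using mul_nonneg hε (hw j), by rwa [add_zero]⟩

end MatPoly

/-! ### The resolvent form of a Jordan triple -/

namespace MatPoly

variable {n m : ℕ}

/-- Taylor coefficients of a matrix polynomial. -/
theorem inv_factorial_smul_derivAt (A : MatPoly n m) (k : ℕ) (z : ℂ) :
    (k.factorial : ℂ)⁻¹ • A.derivAt k z =
      ∑ j : Fin (m + 1), (((j : ℕ).choose k : ℂ) * z ^ ((j : ℕ) - k)) • A j := by
  have hk : (k.factorial : ℂ) ≠ 0 := by exact_mod_cast k.factorial_ne_zero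
  rw [inv_smul_eq_iff₀ hk]
  ext a b
  simp only [derivAt, toMatrix, Matrix.map_apply, Matrix.sum_apply, Matrix.smul_apply,
    smul_eq_mul, Polynomial.iterate_derivative_sum, Polynomial.eval_finsetSum, Finset.mul_sum]
  refine Finset.sum_congr rfl fun j _ => ?_
  rw [mul_comm (Polynomial.X ^ (j : ℕ)), Polynomial.iterate_derivative_C_mul,
    Polynomial.iterate_derivative_X_pow_eq_natCast_mul, Nat.descFactorial_eq_factorial_mul_choose]
  simp
  ring

/-- The inverse of `z I - J` for the Jordan block `J` of size `s` with eigenvalue `l ≠ z`: its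
`k`-th superdiagonal is `(z - l)⁻⁽ᵏ⁺¹⁾`. -/
noncomputable def jordanResolvent (l : ℂ) (s : ℕ) (z : ℂ) : Matrix (Fin s) (Fin s) ℂ :=
  Matrix.of fun a b => if a ≤ b then ((z - l) ^ ((b : ℕ) - a + 1))⁻¹ else 0

theorem sub_jordanBlock_mul_jordanResolvent {l z : ℂ} (hz : z ≠ l) (s : ℕ) :
    (z • 1 - jordanBlock l s) * jordanResolvent l s z = 1 := by
  have hz' : z - l ≠ 0 := sub_ne_zero.2 hz
  ext a b
  have hrow : ∀ c, (z • (1 : Matrix (Fin s) (Fin s) ℂ) - jordanBlock l s) a c =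
      (if a = c then z - l else 0) - (if (a : ℕ) + 1 = c then 1 else 0) := by
    intro c
    by_cases h : a = c
    · subst h; simp [jordanBlock]
    · simp [jordanBlock, h, Matrix.one_apply_ne h]
  simp only [Matrix.mul_apply, hrow, sub_mul, ite_mul, zero_mul, one_mul,
    Finset.sum_sub_distrib, Finset.sum_ite_eq, Finset.mem_univ, if_true]
  have hnext : ∑ c : Fin s, (if (a : ℕ) + 1 = c then jordanResolvent l s z c b else 0) =
      if (a : ℕ) < b then ((z - l) ^ ((b : ℕ) - a))⁻¹ else 0 := by
    by_cases ha : (a : ℕ) + 1 < s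
    · rw [Finset.sum_eq_single (⟨a + 1, ha⟩ : Fin s)]
      · simp only [if_true, jordanResolvent, Matrix.of_apply, Fin.le_def, Nat.succ_le_iff]
        split_ifs with h
        · rw [show (b : ℕ) - (a + 1) + 1 = b - a by omega]
        · rfl
      · intro c _ hc
        rw [if_neg fun h => hc (Fin.ext h.symm)]
      · simp
    · rw [if_neg (by omega)]
      refine Finset.sum_eq_zero fun c _ => if_neg (by omega)
  rw [hnext]
  rcases lt_trichotomy a b with h | h | h
  · have h' : (a : ℕ) < b := h
    rw [Matrix.one_apply_ne h.ne, jordanResolvent, Matrix.of_apply, if_pos h.le, if_pos h',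
      pow_succ']
    field_simp
    simp
  · subst h
    rw [jordanResolvent, Matrix.of_apply, if_pos le_rfl, if_neg (lt_irrefl _), Nat.sub_self,
      zero_add, pow_one, ← sub_mul, mul_inv_cancel₀ hz', sub_zero, Matrix.one_apply_eq]
  · have h' : ¬ (a : ℕ) < b := not_lt.2 h.le
    simp [jordanResolvent, not_le.2 h, h', Matrix.one_apply_ne h.ne']

namespace JordanSystem

variable {A : MatPoly n m} (T : JordanSystem A)

/-- The inverse of `z I - J` when `z` is none of the eigenvalues. -/
noncomputable def resolvent (z : ℂ) : Matrix T.Idx T.Idx ℂ :=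
  Matrix.blockDiagonal' fun i => jordanResolvent (T.eig i) (T.len i) z

theorem sub_J_mul_resolvent {z : ℂ} (hz : ∀ i, z ≠ T.eig i) :
    (z • 1 - T.J) * T.resolvent z = 1 := by
  have h1 : (z • 1 - T.J) =
      Matrix.blockDiagonal' fun i => z • 1 - jordanBlock (T.eig i) (T.len i) := by
    rw [J, ← Matrix.blockDiagonal'_one, ← Matrix.blockDiagonal'_smul, ← Matrix.blockDiagonal'_sub]
    rfl
  rw [h1, resolvent, ← Matrix.blockDiagonal'_mul, ← Matrix.blockDiagonal'_one]
  congr 1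
  ext1 i
  exact sub_jordanBlock_mul_jordanResolvent (hz i) _

/-- Multiplication by `J` on the right. -/
theorem mul_J_apply {α : Type*} (M : Matrix α T.Idx ℂ) (a : α) (i : Fin T.r) (b : Fin (T.len i)) :
    (M * T.J) a ⟨i, b⟩ = M a ⟨i, b⟩ * T.eig i +
      ∑ c : Fin (T.len i), if (c : ℕ) + 1 = b then M a ⟨i, c⟩ else 0 := by
  rw [Matrix.mul_apply, Fintype.sum_sigma, Finset.sum_eq_single i]
  · have : ∀ c : Fin (T.len i), M a ⟨i, c⟩ * T.J ⟨i, c⟩ ⟨i, b⟩ =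
        (if c = b then M a ⟨i, b⟩ * T.eig i else 0) +
          (if (c : ℕ) + 1 = b then M a ⟨i, c⟩ else 0) := by
      intro c
      rw [J, Matrix.blockDiagonal'_apply_eq, jordanBlock, Matrix.of_apply]
      by_cases h : c = b
      · subst h; simp
      · simp [h]
    rw [Finset.sum_congr rfl fun c _ => this c, Finset.sum_add_distrib]
    simp
  · intro i' _ hi'
    refine Finset.sum_eq_zero fun c _ => ?_
    rw [J, Matrix.blockDiagonal'_apply_ne _ _ _ hi', mul_zero]
  · simp

theorem X_mul_J_pow_apply (j : ℕ) (a : Fin n) (i : Fin T.r) (b : Fin (T.len i)) :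
    (T.X * T.J ^ j) a ⟨i, b⟩ = ∑ k ∈ Finset.range ((b : ℕ) + 1),
      ((j.choose k : ℂ) * T.eig i ^ (j - k)) * T.vec i (b - k) a := by
  induction j generalizing b with
  | zero =>
    rw [Finset.sum_range_succ']
    simp [X]
  | succ j ih =>
    have pascal : ∀ k : ℕ, (((j + 1).choose (k + 1) : ℂ) * T.eig i ^ (j + 1 - (k + 1))) =
        (j.choose (k + 1) * T.eig i ^ (j - (k + 1))) * T.eig i
          + j.choose k * T.eig i ^ (j - k) := by
      intro k
      rw [Nat.choose_succ_succ, Nat.add_sub_add_right]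
      push_cast
      rcases lt_or_ge j (k + 1) with h | h
      · rw [Nat.choose_eq_zero_of_lt h]; simp
      · rw [mul_assoc, ← pow_succ, show j - (k + 1) + 1 = j - k by omega]; ring
    have hshift : ∑ c : Fin (T.len i), (if (c : ℕ) + 1 = b then (T.X * T.J ^ j) a ⟨i, c⟩ else 0) =
        ∑ k ∈ Finset.range (b : ℕ),
          ((j.choose k : ℂ) * T.eig i ^ (j - k)) * T.vec i (b - (k + 1)) a := by
      rcases Nat.eq_zero_or_pos (b : ℕ) with hb | hb
      · rw [hb]
        exact Finset.sum_eq_zero fun c _ => if_neg (by omega)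
      · have hb' : (b : ℕ) - 1 < T.len i := by omega
        rw [Finset.sum_eq_single (⟨b - 1, hb'⟩ : Fin (T.len i))]
        · rw [if_pos (Nat.sub_add_cancel hb), ih]
          simp only [Nat.sub_add_cancel hb]
          refine Finset.sum_congr rfl fun k _ => ?_
          rw [Nat.sub_sub, add_comm 1 k]
        · intro c _ hc
          exact if_neg fun h => hc (Fin.ext (by simp only; omega))
        · simp
    rw [pow_succ, ← Matrix.mul_assoc, mul_J_apply, ih, hshift, Finset.sum_range_succ',
      Finset.sum_range_succ']
    simp only [pascal, add_mul, Finset.sum_add_distrib, Finset.sum_mul]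
    simp only [Nat.choose_zero_right, Nat.cast_one, one_mul, Nat.sub_zero, pow_succ]
    rw [add_right_comm]
    congr 1
    congr 1
    · exact Finset.sum_congr rfl fun k _ => by ring
    · ring

/-- The Jordan chain conditions, collected in one matrix equation. -/
theorem sum_mul_X_mul_J_pow : ∑ j : Fin (m + 1), A j * (T.X * T.J ^ (j : ℕ)) = 0 := by
  ext a ⟨i, b⟩
  have h := congrFun ((T.isChain i).eq_zero b b.2) a
  simp only [inv_factorial_smul_derivAt, Finset.sum_apply, Matrix.mulVec, dotProduct,
    Matrix.sum_apply, Matrix.smul_apply, smul_eq_mul, Finset.sum_mul, Pi.zero_apply] at h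
  have hmul : ∀ j : Fin (m + 1), (A j * (T.X * T.J ^ (j : ℕ))) a ⟨i, b⟩ =
      ∑ c, ∑ k ∈ Finset.range ((b : ℕ) + 1),
        A j a c * (((j : ℕ).choose k : ℂ) * T.eig i ^ ((j : ℕ) - k) * T.vec i (b - k) c) := by
    intro j
    rw [Matrix.mul_apply]
    simp only [X_mul_J_pow_apply, Finset.mul_sum]
  rw [Matrix.sum_apply, Finset.sum_congr rfl fun j _ => hmul j, Matrix.zero_apply, ← h,
    Finset.sum_comm, Finset.sum_comm (s := Finset.range _)]
  refine Finset.sum_congr rfl fun c _ => ?_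
  rw [Finset.sum_comm]
  exact Finset.sum_congr rfl fun k _ => Finset.sum_congr rfl fun j _ => by ring

/-- An eigenvector of `J` is a combination of the positions of the heads of the chains at one
eigenvalue, and the columns of `X` in these positions are independent. -/
theorem eq_zero_of_J_mulVec_eq_smul {l : ℂ} {v : T.Idx → ℂ} (hJv : T.J.mulVec v = l • v)
    (hXv : T.X.mulVec v = 0) : v = 0 := by
  have hrow : ∀ (i : Fin T.r) (b : Fin (T.len i)), (T.J.mulVec v) ⟨i, b⟩ =
      T.eig i * v ⟨i, b⟩ + ∑ d : Fin (T.len i), if (b : ℕ) + 1 = d then v ⟨i, d⟩ else 0 := by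
    intro i b
    rw [Matrix.mulVec, dotProduct, Fintype.sum_sigma, Finset.sum_eq_single i]
    · have : ∀ d : Fin (T.len i), T.J ⟨i, b⟩ ⟨i, d⟩ * v ⟨i, d⟩ =
          (if b = d then T.eig i * v ⟨i, d⟩ else 0) +
            (if (b : ℕ) + 1 = d then v ⟨i, d⟩ else 0) := by
        intro d
        rw [J, Matrix.blockDiagonal'_apply_eq, jordanBlock, Matrix.of_apply]
        by_cases h : b = d
        · subst h; simp
        · simp [h]
      rw [Finset.sum_congr rfl fun d _ => this d, Finset.sum_add_distrib]
      simp
    · intro i' _ hi'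
      refine Finset.sum_eq_zero fun d _ => ?_
      rw [J, Matrix.blockDiagonal'_apply_ne _ _ _ hi'.symm, zero_mul]
    · simp
  have hnext : ∀ (i : Fin T.r) (b : ℕ) (hb : b + 1 < T.len i),
      T.eig i * v ⟨i, ⟨b, (Nat.lt_succ_self b).trans hb⟩⟩ + v ⟨i, ⟨b + 1, hb⟩⟩ =
        l * v ⟨i, ⟨b, (Nat.lt_succ_self b).trans hb⟩⟩ := by
    intro i b hb
    have h := congrFun hJv ⟨i, ⟨b, (Nat.lt_succ_self b).trans hb⟩⟩
    rw [hrow, Finset.sum_eq_single (⟨b + 1, hb⟩ : Fin (T.len i))] at h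
    · simpa using h
    · intro d _ hd
      exact if_neg fun h => hd (Fin.ext h.symm)
    · simp
  have hlast : ∀ i : Fin T.r, T.eig i ≠ l → v (T.lastIdx i) = 0 := by
    intro i hi
    have h := congrFun hJv (T.lastIdx i)
    rw [lastIdx, hrow, Finset.sum_eq_zero, add_zero, Pi.smul_apply, smul_eq_mul] at h
    · have h' : (T.eig i - l) * v (T.lastIdx i) = 0 := by
        rw [sub_mul, sub_eq_zero]; exact h
      exact (mul_eq_zero.1 h').resolve_left (sub_ne_zero.2 hi)
    · intro d _
      have := (T.isChain i).pos
      exact if_neg (by simp only; omega)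
  -- Off the eigenvalue `l` the entries of `v` vanish, by descent from the end of the chain.
  have hoff : ∀ i : Fin T.r, T.eig i ≠ l → ∀ b : Fin (T.len i), v ⟨i, b⟩ = 0 := by
    intro i hi
    have key : ∀ k : ℕ, ∀ b : Fin (T.len i), (b : ℕ) + 1 + k = T.len i → v ⟨i, b⟩ = 0 := by
      intro k
      induction k with
      | zero =>
        intro b hb
        have : b = ⟨T.len i - 1, Nat.sub_lt (T.isChain i).pos Nat.one_pos⟩ :=
          Fin.ext (by simp only; omega)
        rw [this]
        exact hlast i hi
      | succ k ih =>
        intro b hb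
        have hb' : (b : ℕ) + 1 < T.len i := by omega
        have h := hnext i b hb'
        rw [ih ⟨b + 1, hb'⟩ (by simp only; omega), add_zero] at h
        have h' : (T.eig i - l) * v ⟨i, b⟩ = 0 := by
          rw [sub_mul, sub_eq_zero]; exact h
        exact (mul_eq_zero.1 h').resolve_left (sub_ne_zero.2 hi)
    intro b
    exact key (T.len i - (b + 1)) b (by omega)
  -- At the eigenvalue `l` only the entries at the heads of the chains survive.
  have hon : ∀ i : Fin T.r, T.eig i = l → ∀ b : Fin (T.len i), (b : ℕ) ≠ 0 → v ⟨i, b⟩ = 0 := by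
    intro i hi b hb
    obtain ⟨b', hb'⟩ := Nat.exists_eq_succ_of_ne_zero hb
    have hb'' : b' + 1 < T.len i := by omega
    have h := hnext i b' hb''
    rw [hi, add_eq_left] at h
    rwa [show b = ⟨b' + 1, hb''⟩ from Fin.ext hb']
  let head : Fin T.r → T.Idx := fun i => ⟨i, ⟨0, (T.isChain i).pos⟩⟩
  have hhead : ∑ i : {i : Fin T.r // T.eig i = l}, v (head i) • T.vec i 0 = 0 := by
    rw [← hXv]
    ext a
    have hchain : ∀ i : Fin T.r, ∑ b, T.X a ⟨i, b⟩ * v ⟨i, b⟩ =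
        if T.eig i = l then v (head i) * T.vec i 0 a else 0 := by
      intro i
      split_ifs with hi
      · rw [Finset.sum_eq_single (⟨0, (T.isChain i).pos⟩ : Fin (T.len i)), mul_comm]
        · rfl
        · intro b _ hb
          rw [hon i hi b fun h => hb (Fin.ext h), mul_zero]
        · simp
      · exact Finset.sum_eq_zero fun b _ => by rw [hoff i hi b, mul_zero]
    rw [Matrix.mulVec, dotProduct, Fintype.sum_sigma, Finset.sum_congr rfl fun i _ => hchain i,
      ← Finset.sum_filter, Finset.sum_apply,
      Finset.sum_subtype (p := fun i => T.eig i = l) _ (by simp)]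
    rfl
  have hzero := Fintype.linearIndependent_iff.1 (T.indep l) (fun i => v (head i)) hhead
  ext ⟨i, b⟩
  by_cases hi : T.eig i = l
  · by_cases hb : (b : ℕ) = 0
    · have := hzero ⟨i, hi⟩
      rwa [show b = ⟨0, (T.isChain i).pos⟩ from Fin.ext hb]
    · exact hon i hi b hb
  · exact hoff i hi b

/-- The columns of `Q` are independent. Since `A_m` is invertible, the kernel of `Q` is invariant
under `J`, so if it were nonzero it would contain an eigenvector of `J`, on which `X` vanishes. -/
theorem Q_mulVec_eq_zero (hA : (A (Fin.last m)).det ≠ 0) (hm : m ≠ 0) {c : T.Idx → ℂ}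
    (hc : T.Q.mulVec c = 0) : c = 0 := by
  have hQ : ∀ v : T.Idx → ℂ, T.Q.mulVec v = 0 ↔
      ∀ j < m, (T.X * T.J ^ j).mulVec v = 0 := by
    intro v
    constructor
    · intro h j hj
      ext a
      exact congrFun h (⟨j, hj⟩, a)
    · intro h
      ext ⟨j, a⟩
      exact congrFun (h j j.2) a
  -- The kernel of `Q` is invariant under `J`.
  have hinv : ∀ v : T.Idx → ℂ, T.Q.mulVec v = 0 → T.Q.mulVec (T.J.mulVec v) = 0 := by
    intro v hv
    rw [hQ] at hv ⊢
    intro j hj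
    rw [Matrix.mulVec_mulVec, Matrix.mul_assoc, ← pow_succ]
    rcases (Nat.succ_le_of_lt hj).lt_or_eq with h | h
    · exact hv _ h
    · have hs := congrArg (fun M => M.mulVec v) T.sum_mul_X_mul_J_pow
      simp only [Fin.sum_univ_castSucc, Matrix.add_mulVec, Matrix.zero_mulVec,
        Matrix.sum_mulVec, ← Matrix.mulVec_mulVec, Fin.val_castSucc, Fin.val_last] at hs
      rw [Finset.sum_eq_zero, zero_add] at hs
      · rw [← Nat.succ_eq_add_one, h]
        simp only [← Matrix.mulVec_mulVec]
        exact Matrix.eq_zero_of_mulVec_eq_zero hA hs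
      · intro k _
        have := hv k k.2
        rw [← Matrix.mulVec_mulVec] at this
        rw [this, Matrix.mulVec_zero]
  by_contra hc0
  let K : Submodule ℂ (T.Idx → ℂ) := LinearMap.ker T.Q.mulVecLin
  have hK : ∀ v ∈ K, T.J.mulVecLin v ∈ K := fun v hv => hinv v hv
  have : Nontrivial K := ⟨⟨⟨c, hc⟩, 0, fun h => hc0 (congrArg Subtype.val h)⟩⟩
  obtain ⟨l, hl⟩ := Module.End.exists_eigenvalue (T.J.mulVecLin.restrict hK)
  obtain ⟨⟨v, hvK⟩, hv⟩ := hl.exists_hasEigenvector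
  have hv0 : v ≠ 0 := fun h => hv.2 (Subtype.ext h)
  have hJv : T.J.mulVec v = l • v := congrArg Subtype.val hv.apply_eq_smul
  have hXv : T.X.mulVec v = 0 := by
    have := (hQ v).1 hvK 0 (Nat.pos_of_ne_zero hm)
    rwa [pow_zero, Matrix.mul_one] at this
  exact hv0 (T.eq_zero_of_J_mulVec_eq_smul hJv hXv)

/-- The block rows of `Q Y = [0; …; 0; A_m⁻¹]`. -/
theorem X_mul_J_pow_mul_Y (hA : (A (Fin.last m)).det ≠ 0) {j : ℕ} (hj : j < m) :
    T.X * T.J ^ j * T.Y = if j + 1 = m then (A (Fin.last m))⁻¹ else 0 := by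
  have hm : m ≠ 0 := by omega
  set S := T.Q.submatrix id T.numbering.symm with hS
  have hdet : IsUnit S.det := by
    rw [isUnit_iff_ne_zero]
    intro h0
    obtain ⟨v, hv0, hv⟩ := Matrix.exists_mulVec_eq_zero_iff.2 h0
    apply hv0
    have : T.Q.mulVec (v ∘ T.numbering) = 0 := by
      rw [hS, Matrix.submatrix_mulVec_equiv] at hv
      simpa using hv
    have := T.Q_mulVec_eq_zero hA hm this
    ext p
    simpa using congrFun this (T.numbering.symm p)
  have hQY : T.Q * T.Y = lastBlock A := by
    have : T.Q = S.submatrix id T.numbering := by ext; simp [hS]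
    rw [Y, ← hS, this, Matrix.submatrix_mul_equiv, Matrix.mul_nonsing_inv_cancel_left _ _ hdet,
      Matrix.submatrix_id_id]
  ext a b
  have h := congrFun (congrFun hQY (⟨j, hj⟩, a)) b
  have h' : (T.X * T.J ^ j * T.Y) a b = (T.Q * T.Y) (⟨j, hj⟩, a) b := rfl
  rw [h', h, lastBlock, Matrix.of_apply]
  split_ifs <;> rfl

/-- The inverse of `P(z)` is `X (z I - J)⁻¹ Y`. -/
theorem eval_mul_X_mul_resolvent_mul_Y (hA : (A (Fin.last m)).det ≠ 0) (hm : m ≠ 0) {z : ℂ}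
    (hz : ∀ i, z ≠ T.eig i) : A.eval z * (T.X * T.resolvent z * T.Y) = 1 := by
  have hcomm : Commute (z • (1 : Matrix T.Idx T.Idx ℂ)) T.J := (Commute.one_left _).smul_left z
  have hgeom : ∀ j : ℕ, T.X * ((z • 1) ^ j - T.J ^ j) * T.resolvent z * T.Y =
      ∑ k ∈ Finset.range j, z ^ k • (T.X * T.J ^ (j - 1 - k) * T.Y) := by
    intro j
    rw [← hcomm.geom_sum₂_mul, Matrix.mul_assoc T.X, Matrix.mul_assoc _ _ (T.resolvent z),
      T.sub_J_mul_resolvent hz, Matrix.mul_one, Matrix.mul_sum, Matrix.sum_mul]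
    refine Finset.sum_congr rfl fun k _ => ?_
    rw [smul_pow, one_pow, smul_mul_assoc, one_mul, Matrix.mul_smul, Matrix.smul_mul]
  have hPX : A.eval z * T.X =
      ∑ j : Fin (m + 1), A j * (T.X * ((z • 1) ^ (j : ℕ) - T.J ^ (j : ℕ))) := by
    simp only [Matrix.mul_sub, Finset.sum_sub_distrib, T.sum_mul_X_mul_J_pow, sub_zero]
    rw [eval, Matrix.sum_mul]
    refine Finset.sum_congr rfl fun j _ => ?_
    rw [smul_pow, one_pow, Matrix.mul_smul, Matrix.mul_one, Matrix.mul_smul, Matrix.smul_mul]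
  have hsum : A.eval z * (T.X * T.resolvent z * T.Y) = ∑ j : Fin (m + 1),
      A j * ∑ k ∈ Finset.range (j : ℕ), z ^ k • (T.X * T.J ^ ((j : ℕ) - 1 - k) * T.Y) := by
    simp only [← hgeom]
    rw [← Matrix.mul_assoc, ← Matrix.mul_assoc, hPX, Matrix.sum_mul, Matrix.sum_mul]
    simp only [Matrix.mul_assoc]
  -- Only `j = m`, `k = 0` contributes, because `X J ^ i Y = 0` for `i < m - 1`.
  rw [hsum, Fin.sum_univ_castSucc, Finset.sum_eq_zero, zero_add, Fin.val_last,
    Finset.sum_eq_single 0, T.X_mul_J_pow_mul_Y hA (by omega), if_pos (by omega), pow_zero,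
    one_smul, Matrix.mul_nonsing_inv _ (isUnit_iff_ne_zero.2 hA)]
  · intro k hk hk0
    rw [Finset.mem_range] at hk
    rw [T.X_mul_J_pow_mul_Y hA (by omega), if_neg (by omega), smul_zero]
  · intro h
    exact absurd (Finset.mem_range.2 (Nat.pos_of_ne_zero hm)) h
  · intro j _
    rw [Finset.sum_eq_zero, Matrix.mul_zero]
    intro k hk
    have hj := j.2
    rw [Fin.val_castSucc, Finset.mem_range] at hk
    rw [Fin.val_castSucc, T.X_mul_J_pow_mul_Y hA (by omega), if_neg (by omega), smul_zero]

end JordanSystem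

end MatPoly

/-! ### The leading term of the resolvent at an eigenvalue -/

section LeadingTerm

open Filter

namespace MatPoly

variable {n m : ℕ}

theorem tendsto_pow_smul_jordanResolvent {l l0 : ℂ} {s p : ℕ} (hp : p ≠ 0) (hs : l = l0 → s ≤ p) :
    Tendsto (fun z => (z - l0) ^ p • jordanResolvent l s z) (𝓝[≠] l0)
      (𝓝 (Matrix.of fun a b : Fin s =>
        if (l = l0 ∧ s = p) ∧ (a : ℕ) = 0 ∧ (b : ℕ) + 1 = s then (1 : ℂ) else 0)) := by
  refine tendsto_pi_nhds.2 fun a => tendsto_pi_nhds.2 fun b => ?_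
  simp only [Matrix.smul_apply, jordanResolvent, Matrix.of_apply, smul_eq_mul]
  have hpow : ∀ k : ℕ, Tendsto (fun z : ℂ => (z - l0) ^ k) (𝓝[≠] l0) (𝓝 (0 ^ k)) := by
    intro k
    have h : Continuous fun z : ℂ => (z - l0) ^ k := by fun_prop
    have h' := h.tendsto l0
    rw [sub_self] at h'
    exact h'.mono_left nhdsWithin_le_nhds
  have ha := a.2
  have hb := b.2
  by_cases hab : a ≤ b
  · have hab' : (a : ℕ) ≤ b := hab
    simp only [if_pos hab]
    by_cases hl : l = l0
    · have hsp := hs hl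
      subst hl
      have hlim : (if (l = l ∧ s = p) ∧ (a : ℕ) = 0 ∧ (b : ℕ) + 1 = s then (1 : ℂ) else 0) =
          0 ^ (p - (b - a + 1)) := by
        rw [zero_pow_eq]
        refine if_congr ⟨fun h => ?_, fun h => ⟨⟨rfl, ?_⟩, ?_, ?_⟩⟩ rfl rfl <;> omega
      rw [hlim]
      refine (hpow _).congr' ?_
      filter_upwards [self_mem_nhdsWithin] with z hz
      rw [pow_sub₀ _ (sub_ne_zero.2 hz) (by omega)]
    · have hcont : Tendsto (fun z : ℂ => ((z - l) ^ ((b : ℕ) - a + 1))⁻¹) (𝓝[≠] l0)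
          (𝓝 ((l0 - l) ^ ((b : ℕ) - a + 1))⁻¹) := by
        have h : ContinuousAt (fun z : ℂ => ((z - l) ^ ((b : ℕ) - a + 1))⁻¹) l0 :=
          ContinuousAt.inv₀ (by fun_prop) (pow_ne_zero _ (sub_ne_zero.2 (Ne.symm hl)))
        exact h.tendsto.mono_left nhdsWithin_le_nhds
      have h := (hpow p).mul hcont
      rw [zero_pow hp, zero_mul] at h
      rwa [if_neg fun h => hl h.1.1]
  · have hab' : ¬ (a : ℕ) ≤ b := hab
    simp only [if_neg hab, mul_zero]
    rw [if_neg (by omega)]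
    exact tendsto_const_nhds

namespace JordanSystem

variable {A : MatPoly n m} (T : JordanSystem A)

/-- The product `X̂ Ŷ` picks out, in each largest block at `l0`, the corner entry that pairs the first
column of `X` with the last row of `Y`. -/
theorem hatX_mul_hatY (l0 : ℂ) :
    T.hatX l0 * T.hatY l0 = T.X * (Matrix.blockDiagonal' fun i => Matrix.of
      fun a b : Fin (T.len i) => if (T.eig i = l0 ∧ T.len i = T.maxBlockSize l0) ∧
        (a : ℕ) = 0 ∧ (b : ℕ) + 1 = T.len i then (1 : ℂ) else 0) * T.Y := by
  ext a b
  have hXD : ∀ (i : Fin T.r) (d : Fin (T.len i)), (T.X * (Matrix.blockDiagonal' fun i => Matrix.of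
      fun a b : Fin (T.len i) => if (T.eig i = l0 ∧ T.len i = T.maxBlockSize l0) ∧
        (a : ℕ) = 0 ∧ (b : ℕ) + 1 = T.len i then (1 : ℂ) else 0)) a ⟨i, d⟩ =
      if T.eig i = l0 ∧ T.len i = T.maxBlockSize l0 then
        (if (d : ℕ) + 1 = T.len i then T.vec i 0 a else 0) else 0 := by
    intro i d
    rw [Matrix.mul_apply, Fintype.sum_sigma, Finset.sum_eq_single i,
      Finset.sum_eq_single (⟨0, (T.isChain i).pos⟩ : Fin (T.len i))]
    · rw [Matrix.blockDiagonal'_apply_eq, Matrix.of_apply, ← ite_and]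
      simp [X]
    · intro c _ hc
      rw [Matrix.blockDiagonal'_apply_eq, Matrix.of_apply,
        if_neg fun h => hc (Fin.ext h.2.1), mul_zero]
    · simp
    · intro i' _ hi'
      exact Finset.sum_eq_zero fun c _ => by
        rw [Matrix.blockDiagonal'_apply_ne _ _ _ hi', mul_zero]
    · simp
  have hchain : ∀ i : Fin T.r, ∑ d : Fin (T.len i),
      (if T.eig i = l0 ∧ T.len i = T.maxBlockSize l0 then
        (if (d : ℕ) + 1 = T.len i then T.vec i 0 a else 0) else 0) * T.Y ⟨i, d⟩ b =
      if T.eig i = l0 ∧ T.len i = T.maxBlockSize l0 then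
        T.vec i 0 a * T.Y (T.lastIdx i) b else 0 := by
    intro i
    have hpos := (T.isChain i).pos
    split_ifs with hi
    · rw [Finset.sum_eq_single (⟨T.len i - 1, Nat.sub_lt hpos Nat.one_pos⟩ : Fin (T.len i)),
        if_pos (by simp only; omega)]
      · rfl
      · intro d _ hd
        rw [if_neg fun h => hd (Fin.ext (by simp only; omega)), zero_mul]
      · simp
    · simp
  rw [Matrix.mul_apply, Matrix.mul_apply, Fintype.sum_sigma]
  simp only [hXD]
  rw [Finset.sum_congr rfl fun i _ => hchain i, ← Finset.sum_filter,
    Finset.sum_subtype (p := fun i => T.eig i = l0 ∧ T.len i = T.maxBlockSize l0) _ (by simp)]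
  rfl

/-- Every eigenvalue belongs to some chain of `T`: otherwise `X (z I - J)⁻¹ Y` would invert `P` there. -/
theorem exists_eig_eq [NeZero n] (hA : (A (Fin.last m)).det ≠ 0) (hm : m ≠ 0) {l0 : ℂ}
    (h0 : l0 ∈ A.spec) : ∃ i, T.eig i = l0 := by
  by_contra! h
  have h1 := congrArg Matrix.det (T.eval_mul_X_mul_resolvent_mul_Y hA hm fun i => (h i).symm)
  rw [Matrix.det_mul, show (A.eval l0).det = 0 from h0, zero_mul, Matrix.det_one] at h1
  exact zero_ne_one h1

theorem maxBlockSize_ne_zero [NeZero n] (hA : (A (Fin.last m)).det ≠ 0) (hm : m ≠ 0) {l0 : ℂ}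
    (h0 : l0 ∈ A.spec) : T.maxBlockSize l0 ≠ 0 := by
  obtain ⟨i, hi⟩ := T.exists_eig_eq hA hm h0
  have h : T.len i ≤ T.maxBlockSize l0 := Finset.le_sup (f := T.len) (by simp [hi])
  have := (T.isChain i).pos
  omega

/-- The matrix `X̂ Ŷ` is the coefficient of `(z - l₀)⁻ᵖ` in the Laurent expansion of `P(z)⁻¹`, where
`p` is the size of the largest Jordan blocks at `l₀`. -/
theorem tendsto_pow_smul_X_mul_resolvent_mul_Y {l0 : ℂ} (hp : T.maxBlockSize l0 ≠ 0) :
    Tendsto (fun z => (z - l0) ^ T.maxBlockSize l0 • (T.X * T.resolvent z * T.Y)) (𝓝[≠] l0)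
      (𝓝 (T.hatX l0 * T.hatY l0)) := by
  rw [hatX_mul_hatY]
  have hblock := tendsto_pi_nhds.2 fun i : Fin T.r =>
    tendsto_pow_smul_jordanResolvent (l := T.eig i) (l0 := l0) (s := T.len i) hp
      fun hi => Finset.le_sup (f := T.len) (by simp [hi])
  have hcont : Continuous fun D : (∀ i : Fin T.r, Matrix (Fin (T.len i)) (Fin (T.len i)) ℂ) =>
      T.X * Matrix.blockDiagonal' D * T.Y :=
    (continuous_const.matrix_mul continuous_id.matrix_blockDiagonal').matrix_mul continuous_const
  refine ((hcont.tendsto _).comp hblock).congr fun z => ?_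
  simp only [Function.comp_apply]
  have : (Matrix.blockDiagonal' fun i =>
      (z - l0) ^ T.maxBlockSize l0 • jordanResolvent (T.eig i) (T.len i) z) =
      (z - l0) ^ T.maxBlockSize l0 • T.resolvent z := by
    rw [resolvent, ← Matrix.blockDiagonal'_smul]
    rfl
  rw [this, Matrix.mul_smul, Matrix.smul_mul]

theorem eventually_forall_ne_eig (l0 : ℂ) : ∀ᶠ z in 𝓝[≠] l0, ∀ i, z ≠ T.eig i := by
  rw [eventually_all]
  intro i
  by_cases hi : T.eig i = l0
  · rw [hi]
    exact self_mem_nhdsWithin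
  · exact (eventually_ne_nhds (Ne.symm hi)).filter_mono nhdsWithin_le_nhds

end JordanSystem

end MatPoly

end LeadingTerm

/-! ### Components of nearly circular sets -/

section Component

open Filter Metric

theorem exists_mem_closedBall_dist_le_sub {E : Type*} [NormedAddCommGroup E] [NormedSpace ℝ E]
    {x y : E} {a b : ℝ} (ha : 0 ≤ a) (hab : a ≤ b) (hy : y ∈ closedBall x b) :
    ∃ y' ∈ closedBall x a, dist y y' ≤ b - a := by
  have hb := ha.trans hab
  rw [mem_closedBall] at hy
  have hab0 : 0 ≤ a / b := div_nonneg ha hb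
  have hab1 : a / b ≤ 1 := div_le_one_of_le₀ hab hb
  have hmul : a / b * b = a := div_mul_cancel_of_imp fun h => le_antisymm (h ▸ hab) ha
  refine ⟨AffineMap.lineMap x y (a / b), ?_, ?_⟩
  · rw [mem_closedBall, dist_lineMap_left, Real.norm_of_nonneg hab0, dist_comm]
    calc a / b * dist y x ≤ a / b * b := by gcongr
      _ = a := hmul
  · rw [dist_comm, dist_lineMap_right, Real.norm_of_nonneg (sub_nonneg.2 hab1), dist_comm]
    calc (1 - a / b) * dist y x ≤ (1 - a / b) * b := by
          gcongr
      _ = b - a := by rw [sub_mul, one_mul, hmul]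

theorem hausdorffDist_closedBall_le {E : Type*} [NormedAddCommGroup E] [NormedSpace ℝ E]
    {C : Set E} {x : E} {a r b : ℝ} (ha : 0 ≤ a) (har : a ≤ r) (hrb : r ≤ b)
    (h1 : closedBall x a ⊆ C) (h2 : C ⊆ closedBall x b) :
    hausdorffDist C (closedBall x r) ≤ b - a := by
  refine hausdorffDist_le_of_mem_dist (by linarith) (fun y hy => ?_) fun y hy => ?_
  · obtain ⟨y', hy', hd⟩ := exists_mem_closedBall_dist_le_sub (ha.trans har) hrb (h2 hy)
    exact ⟨y', hy', by linarith⟩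
  · obtain ⟨y', hy', hd⟩ := exists_mem_closedBall_dist_le_sub ha har hy
    exact ⟨y', h1 hy', by linarith⟩

/-- A connected set cannot jump over the annulus between radius `b` and radius `ρ`. -/
theorem connectedComponentIn_subset_closedBall {α : Type*} [PseudoMetricSpace α] {S : Set α} {x : α}
    {b ρ : ℝ} (hb : 0 ≤ b) (hbρ : b < ρ) (hx : x ∈ S) (h : S ∩ ball x ρ ⊆ closedBall x b) :
    connectedComponentIn S x ⊆ closedBall x b := by
  intro y hy
  by_contra hyb
  have hyρ : ρ ≤ dist y x := by
    by_contra! hlt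
    exact hyb (h ⟨connectedComponentIn_subset S x hy, hlt⟩)
  obtain ⟨u, hu, hud⟩ := isPreconnected_connectedComponentIn.intermediate_value
    (mem_connectedComponentIn hx) hy (f := fun u => dist u x) (by fun_prop)
    (show (b + ρ) / 2 ∈ Set.Icc (dist x x) (dist y x) from
      ⟨by rw [dist_self]; linarith, by linarith⟩)
  simp only at hud
  have hmem := h ⟨connectedComponentIn_subset S x hu, by rw [mem_ball]; linarith⟩
  rw [mem_closedBall] at hmem
  linarith

theorem Real.le_rpow_one_div_natCast_iff {y a : ℝ} {p : ℕ} (hp : p ≠ 0) (hy : 0 ≤ y) (ha : 0 ≤ a) :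
    y ≤ a ^ (1 / (p : ℝ)) ↔ y ^ p ≤ a := by
  rw [one_div, Real.le_rpow_inv_iff_of_pos hy ha (by positivity), Real.rpow_natCast]

/-- If, near `x`, the set `S ε` is described by `‖z - x‖ ^ p ≤ ε g(z)` with `g` tending to `K`
at `x`, then its component containing `x` is the disc of radius `(K ε)^(1/p)` up to an error
`o(ε^(1/p))`; here `K = 0` is allowed. For every `δ > 0` and small `ε` the component lies between the
discs of radii `((K ± δ) ε)^(1/p)`, where `K - δ` is replaced by `0` if it is negative. -/
theorem hausdorffDist_connectedComponentIn_closedBall {S : ℝ → Set ℂ} {x : ℂ} {p : ℕ} (hp : p ≠ 0)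
    {K : ℝ} (hK : 0 ≤ K) {g : ℂ → ℝ} (hg : Tendsto g (𝓝[≠] x) (𝓝 K))
    (hx : ∀ ε > 0, x ∈ S ε)
    (hS : ∀ᶠ z in 𝓝[≠] x, ∀ ε > 0, z ∈ S ε ↔ ‖z - x‖ ^ p ≤ ε * g z) :
    (∀ᶠ ε in 𝓝[>] (0 : ℝ), hausdorffEDist (connectedComponentIn (S ε) x)
        (closedBall x ((K * ε) ^ (1 / (p : ℝ)))) ≠ ⊤) ∧
    (fun ε : ℝ => hausdorffDist (connectedComponentIn (S ε) x)
        (closedBall x ((K * ε) ^ (1 / (p : ℝ)))))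
      =o[𝓝[>] (0 : ℝ)] fun ε : ℝ => ε ^ (1 / (p : ℝ)) := by
  have hp' : 0 < 1 / (p : ℝ) := by positivity
  -- The sandwich between two discs; at the centre `x` itself only `hx` is available.
  have sandwich : ∀ δ > 0, ∀ᶠ ε in 𝓝[>] (0 : ℝ),
      closedBall x ((max (K - δ) 0 * ε) ^ (1 / (p : ℝ))) ⊆ connectedComponentIn (S ε) x ∧
      connectedComponentIn (S ε) x ⊆ closedBall x (((K + δ) * ε) ^ (1 / (p : ℝ))) := by
    intro δ hδ
    have hev := (hg.eventually (Metric.ball_mem_nhds K hδ)).and hS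
    rw [eventually_nhdsWithin_iff, Metric.eventually_nhds_iff] at hev
    obtain ⟨ρ, hρ, hnear⟩ := hev
    have hsmall : Tendsto (fun ε : ℝ => ((K + δ) * ε) ^ (1 / (p : ℝ))) (𝓝[>] 0) (𝓝 0) := by
      have hc : Continuous fun ε : ℝ => ((K + δ) * ε) ^ (1 / (p : ℝ)) :=
        (continuous_const.mul continuous_id).rpow_const fun _ => Or.inr hp'.le
      have h0 := hc.tendsto 0
      rw [mul_zero, Real.zero_rpow hp'.ne'] at h0
      exact h0.mono_left nhdsWithin_le_nhds
    filter_upwards [hsmall.eventually_lt_const hρ, self_mem_nhdsWithin] with ε hε hε0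
    replace hε0 : 0 < ε := hε0
    have hout : 0 ≤ (K + δ) * ε := by positivity
    have hin : 0 ≤ max (K - δ) 0 * ε := mul_nonneg (le_max_right _ _) hε0.le
    have hinout : (max (K - δ) 0 * ε) ^ (1 / (p : ℝ)) ≤ ((K + δ) * ε) ^ (1 / (p : ℝ)) := by
      gcongr
      exact max_le (by linarith) (by linarith)
    constructor
    · refine (convex_closedBall x _).isPreconnected.subset_connectedComponentIn
        (mem_closedBall_self (Real.rpow_nonneg hin _)) fun z hz => ?_
      rcases eq_or_ne z x with rfl | hzx
      · exact hx ε hε0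
      rw [mem_closedBall] at hz
      obtain ⟨hgz, hiff⟩ := hnear ((hz.trans hinout).trans_lt hε) hzx
      rw [Real.dist_eq, abs_lt] at hgz
      rw [dist_eq_norm, Real.le_rpow_one_div_natCast_iff hp (norm_nonneg _) hin] at hz
      rw [hiff ε hε0]
      have hpos : 0 < max (K - δ) 0 * ε :=
        (pow_pos (norm_pos_iff.2 (sub_ne_zero.2 hzx)) p).trans_le hz
      have hmax : max (K - δ) 0 ≤ g z := by
        rcases max_choice (K - δ) 0 with h | h
        · rw [h]; linarith
        · rw [h, zero_mul] at hpos
          exact absurd hpos (lt_irrefl _)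
      calc ‖z - x‖ ^ p ≤ max (K - δ) 0 * ε := hz
        _ ≤ g z * ε := by gcongr
        _ = ε * g z := mul_comm _ _
    · refine connectedComponentIn_subset_closedBall (Real.rpow_nonneg hout _) hε (hx ε hε0) ?_
      rintro z ⟨hzS, hzρ⟩
      rcases eq_or_ne z x with rfl | hzx
      · exact mem_closedBall_self (Real.rpow_nonneg hout _)
      obtain ⟨hgz, hiff⟩ := hnear hzρ hzx
      rw [Real.dist_eq, abs_lt] at hgz
      rw [mem_closedBall, dist_eq_norm,
        Real.le_rpow_one_div_natCast_iff hp (norm_nonneg _) hout]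
      calc ‖z - x‖ ^ p ≤ ε * g z := (hiff ε hε0).1 hzS
        _ ≤ ε * (K + δ) := by gcongr; linarith
        _ = (K + δ) * ε := mul_comm _ _
  constructor
  · filter_upwards [sandwich 1 one_pos, self_mem_nhdsWithin] with ε hε hε0
    replace hε0 : 0 < ε := hε0
    exact hausdorffEDist_ne_top_of_nonempty_of_bounded
      ⟨x, mem_connectedComponentIn (hx ε hε0)⟩
      ⟨x, mem_closedBall_self (Real.rpow_nonneg (mul_nonneg hK hε0.le) _)⟩
      (isBounded_closedBall.subset hε.2) isBounded_closedBall
  · rw [Asymptotics.isLittleO_iff]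
    intro η hη
    -- The widths of the sandwich relative to `ε ^ (1 / p)` shrink with `δ`.
    obtain ⟨δ, hδη, hδ⟩ : ∃ δ : ℝ,
        (K + δ) ^ (1 / (p : ℝ)) - (max (K - δ) 0) ^ (1 / (p : ℝ)) < η ∧ 0 < δ := by
      have hc : Continuous fun δ : ℝ =>
          (K + δ) ^ (1 / (p : ℝ)) - (max (K - δ) 0) ^ (1 / (p : ℝ)) :=
        ((continuous_const.add continuous_id).rpow_const fun _ => Or.inr hp'.le).sub
          (((continuous_const.sub continuous_id).max continuous_const).rpow_const
            fun _ => Or.inr hp'.le)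
      have h0 := hc.tendsto 0
      rw [add_zero, sub_zero, max_eq_left hK, sub_self] at h0
      exact (((h0.mono_left nhdsWithin_le_nhds).eventually_lt_const hη).and
        (self_mem_nhdsWithin : Set.Ioi (0 : ℝ) ∈ 𝓝[>] 0)).exists
    filter_upwards [sandwich δ hδ, self_mem_nhdsWithin] with ε hε hε0
    replace hε0 : 0 < ε := hε0
    have hm0 : 0 ≤ max (K - δ) 0 := le_max_right _ _
    rw [Real.norm_of_nonneg hausdorffDist_nonneg, Real.norm_of_nonneg (Real.rpow_nonneg hε0.le _)]
    calc hausdorffDist (connectedComponentIn (S ε) x) (closedBall x ((K * ε) ^ (1 / (p : ℝ))))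
        ≤ ((K + δ) * ε) ^ (1 / (p : ℝ)) - (max (K - δ) 0 * ε) ^ (1 / (p : ℝ)) := by
          refine hausdorffDist_closedBall_le (by positivity) ?_ ?_ hε.1 hε.2
          · gcongr
            exact max_le (by linarith) hK
          · gcongr
            linarith
      _ = ((K + δ) ^ (1 / (p : ℝ)) - (max (K - δ) 0) ^ (1 / (p : ℝ))) * ε ^ (1 / (p : ℝ)) := by
          rw [Real.mul_rpow (by positivity) hε0.le, Real.mul_rpow hm0 hε0.le, sub_mul]
      _ ≤ η * ε ^ (1 / (p : ℝ)) := by gcongr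

end Component

/-! ### The component of the pseudospectrum at a multiple eigenvalue -/

theorem mainTheorem1 {n m : ℕ} (A : MatPoly n m) (hA : (A (Fin.last m)).det ≠ 0)
    (w : Fin (m + 1) → ℝ) (hw : ∀ j, 0 ≤ w j) (hw0 : 0 < w 0)
    (l0 : ℂ) (hl0 : 2 ≤ A.algMult l0) (T : MatPoly.JordanSystem A) :
    (∀ᶠ ε in 𝓝[>] (0 : ℝ),
      Metric.hausdorffEDist (connectedComponentIn (A.pseudospectrum w ε) l0)
        (Metric.closedBall l0
          ((T.condNumber w l0 * ε) ^ (1 / (T.maxBlockSize l0 : ℝ)))) ≠ ⊤) ∧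
    (fun ε : ℝ =>
      Metric.hausdorffDist (connectedComponentIn (A.pseudospectrum w ε) l0)
        (Metric.closedBall l0
          ((T.condNumber w l0 * ε) ^ (1 / (T.maxBlockSize l0 : ℝ)))))
      =o[𝓝[>] (0 : ℝ)] fun ε : ℝ => ε ^ (1 / (T.maxBlockSize l0 : ℝ)) := by
  have hspec : l0 ∈ A.spec := by
    have hpos : 0 < A.toMatrix.det.rootMultiplicity l0 := by
      rw [MatPoly.algMult] at hl0; omega
    have hroot := Polynomial.rootMultiplicity_pos'.1 hpos
    rw [MatPoly.spec, Set.mem_ofPred_eq, ← MatPoly.det_toMatrix_eval]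
    exact hroot.2
  have hn : NeZero n := by
    refine ⟨?_⟩
    rintro rfl
    exact one_ne_zero ((Matrix.det_isEmpty (A := A.eval l0)).symm.trans hspec)
  have hm : m ≠ 0 := by
    rintro rfl
    apply hA
    have h : (A.eval l0).det = 0 := hspec
    simpa [MatPoly.eval] using h
  have hp := T.maxBlockSize_ne_zero hA hm hspec
  have hK : 0 ≤ T.condNumber w l0 :=
    mul_nonneg (MatPoly.weight_pos hw hw0 (norm_nonneg _)).le (norm_nonneg _)
  refine hausdorffDist_connectedComponentIn_closedBall
    (g := fun z => MatPoly.weight w ‖z‖ *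
      ‖(z - l0) ^ T.maxBlockSize l0 • (T.X * T.resolvent z * T.Y)‖) hp hK ?_
    (fun ε hε => MatPoly.mem_pseudospectrum_of_mem_spec hw (le_of_lt hε) hspec) ?_
  · refine Filter.Tendsto.mul ?_ (T.tendsto_pow_smul_X_mul_resolvent_mul_Y hp).norm
    exact (((MatPoly.continuous_weight w).comp continuous_norm).tendsto l0).mono_left
      nhdsWithin_le_nhds
  · filter_upwards [T.eventually_forall_ne_eig l0, self_mem_nhdsWithin] with z hz hzl ε _
    have hpos : 0 < ‖z - l0‖ ^ T.maxBlockSize l0 :=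
      pow_pos (norm_pos_iff.2 (sub_ne_zero.2 hzl)) _
    rw [MatPoly.mem_pseudospectrum_iff hw hw0 (T.eval_mul_X_mul_resolvent_mul_Y hA hm hz),
      norm_smul, norm_pow, ← mul_le_mul_iff_right₀ hpos, mul_one]
    refine iff_of_eq (congrArg _ ?_)
    ring
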